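/- There is a universal constant $C>0$ such that for every $\varepsilon\in(0,1)$ and every $t\in[-1,1]$ there exist an even polynomial $p\in\mathbb{R}[x]$ and an odd polynomial $q\in\mathbb{R}[x]$, each of degree at most $C\log\frac1\varepsilon$ (the zero polynomial being assigned degree $0$), such that $|p(x)|\le 1$ and $|q(x)|\le 1$ for all $x\in[-1,1]$, and $$|p(x)-\cos(t\arcsin x)|\le\varepsilon\quad\text{and}\quad |q(x)-\sin(t\arcsin x)|\le\varepsilon\qquad\text{for all } x\in\left[-\tfrac12,\tfrac12\right].$$ -/

import Mathlib

open Polynomial Finset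

/-! Both targets solve (1 - x²) y'' - x y' + t² y = 0. Applied to a Taylor truncation, the operator
leaves a single monomial (`arcsinPoly_ode`), and x = sin θ turns it into d²/dθ² + t². The truncation
error thus solves a forced oscillator with zero initial data. For 0 < t ≤ 1 its Duhamel kernel
sin(t(θ - s)) is nonnegative on [0, π/2], so the error has a known sign (`duhamel_bounds`). That
sign gives boundedness without rescaling: the cosine truncation lies between cos(t arcsin x) ≥ 0 and
its constant term 1, the sine truncation between 0 and sin(t arcsin x). For x ≤ 1/2 the forcing is
at most (2m+1)4^(-m), so the error is at most 2^(-m), and m of order log(1/ε) suffices. -/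

/-- Sign and size of the solution of `e'' + t² e = h` with zero initial data. -/
theorem duhamel_bounds {t θ H : ℝ} {e e₁ h : ℝ → ℝ} (ht : 0 < t) (ht1 : t ≤ 1)
    (hθ : 0 ≤ θ) (hθ' : θ ≤ Real.pi / 2) (he0 : e 0 = 0) (he₁0 : e₁ 0 = 0)
    (he : ∀ s, HasDerivAt e (e₁ s) s) (he₁ : ∀ s, HasDerivAt e₁ (h s - t ^ 2 * e s) s)
    (h0 : ∀ s ∈ Set.Icc 0 θ, 0 ≤ h s) (hH : ∀ s ∈ Set.Icc 0 θ, h s ≤ H) :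
    0 ≤ e θ ∧ e θ ≤ H * θ ^ 2 := by
  -- Duhamel without integrals: D' = h(s) sin(t(θ - s)), D(0) = 0 and D(θ) = t e(θ), so bounds on D'
  -- bound e(θ).
  set D : ℝ → ℝ := fun s =>
    e s * (t * Real.cos (t * (θ - s))) + e₁ s * Real.sin (t * (θ - s)) with hDdef
  have hlin : ∀ s, HasDerivAt (fun s : ℝ => t * (θ - s)) (-t) s := fun s => by
    simpa using ((hasDerivAt_id s).const_sub θ).const_mul t
  have hD : ∀ s, HasDerivAt D (h s * Real.sin (t * (θ - s))) s := fun s => by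
    have := ((he s).mul ((hlin s).cos.const_mul t)).add ((he₁ s).mul (hlin s).sin)
    exact this.congr_deriv (by ring)
  have hDiff : Differentiable ℝ D := fun s => (hD s).differentiableAt
  have hD0 : D 0 = 0 := by simp [hDdef, he0, he₁0]
  have hDθ : D θ = t * e θ := by simp [hDdef, mul_comm]
  have hpi := Real.pi_pos
  have hsin : ∀ s ∈ Set.Icc 0 θ, 0 ≤ Real.sin (t * (θ - s)) := fun s hs =>
    Real.sin_nonneg_of_nonneg_of_le_pi (mul_nonneg ht.le (sub_nonneg.2 hs.2))
      (by nlinarith [hs.1, hs.2])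
  have hsin' : ∀ s ∈ Set.Icc 0 θ, Real.sin (t * (θ - s)) ≤ t * θ := fun s hs =>
    (Real.sin_le (mul_nonneg ht.le (sub_nonneg.2 hs.2))).trans (by nlinarith [hs.1, hs.2])
  have lower : 0 * (θ - 0) ≤ D θ - D 0 := by
    refine (convex_Icc 0 θ).mul_sub_le_image_sub_of_le_deriv hDiff.continuous.continuousOn
      hDiff.differentiableOn (fun s hs => ?_) 0 ⟨le_rfl, hθ⟩ θ ⟨hθ, le_rfl⟩ hθ
    have hs' := interior_subset hs
    rw [(hD s).deriv]
    exact mul_nonneg (h0 s hs') (hsin s hs')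
  have upper : D θ - D 0 ≤ (H * (t * θ)) * (θ - 0) := by
    refine (convex_Icc 0 θ).image_sub_le_mul_sub_of_deriv_le hDiff.continuous.continuousOn
      hDiff.differentiableOn (fun s hs => ?_) 0 ⟨le_rfl, hθ⟩ θ ⟨hθ, le_rfl⟩ hθ
    have hs' := interior_subset hs
    rw [(hD s).deriv]
    exact mul_le_mul (hH s hs') (hsin' s hs') (hsin s hs') ((h0 s hs').trans (hH s hs'))
  rw [hD0, hDθ] at lower upper
  refine ⟨nonneg_of_mul_nonneg_right (by linarith) ht, le_of_mul_le_mul_left ?_ ht⟩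
  nlinarith [upper]

/-! ### Taylor truncations and their defect -/

/-- Taylor coefficients of the solutions of `(1 - x²) y'' - x y' + t² y = 0` of parity `s`. -/
noncomputable def arcsinCoeff (t : ℝ) (s : ℕ) (u₀ : ℝ) : ℕ → ℝ
  | 0 => u₀
  | m + 1 => arcsinCoeff t s u₀ m * ((2 * m + s) ^ 2 - t ^ 2) /
      ((2 * m + s + 1) * (2 * m + s + 2))

/-- Taylor polynomials of the solutions of `(1 - x²) y'' - x y' + t² y = 0` of parity `s`. -/
noncomputable def arcsinPoly (t : ℝ) (s : ℕ) (u₀ : ℝ) (m : ℕ) : ℝ[X] :=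
  ∑ j ∈ range (m + 1), C (arcsinCoeff t s u₀ j) * X ^ (2 * j + s)

theorem arcsinPoly_succ (t : ℝ) (s : ℕ) (u₀ : ℝ) (m : ℕ) :
    arcsinPoly t s u₀ (m + 1) =
      arcsinPoly t s u₀ m + C (arcsinCoeff t s u₀ (m + 1)) * X ^ (2 * m + s + 2) := by
  rw [arcsinPoly, sum_range_succ, ← arcsinPoly]
  congr 3
  ring

theorem arcsinPoly_zero (t : ℝ) (s : ℕ) (u₀ : ℝ) :
    arcsinPoly t s u₀ 0 = C u₀ * X ^ s := by
  simp [arcsinPoly, arcsinCoeff]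

theorem eval_arcsinPoly (t : ℝ) (s : ℕ) (u₀ : ℝ) (m : ℕ) (x : ℝ) :
    (arcsinPoly t s u₀ m).eval x =
      ∑ j ∈ range (m + 1), arcsinCoeff t s u₀ j * x ^ (2 * j + s) := by
  simp [arcsinPoly, eval_finsetSum]

theorem natDegree_arcsinPoly_le (t : ℝ) (s : ℕ) (u₀ : ℝ) (m : ℕ) :
    (arcsinPoly t s u₀ m).natDegree ≤ 2 * m + s := by
  refine natDegree_sum_le_of_forall_le _ _ fun j hj => ?_
  have := mem_range.1 hj
  exact (natDegree_C_mul_X_pow_le _ _).trans (by omega)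

theorem eval_neg_arcsinPoly (t : ℝ) (s : ℕ) (u₀ : ℝ) (m : ℕ) (x : ℝ) :
    (arcsinPoly t s u₀ m).eval (-x) = (-1) ^ s * (arcsinPoly t s u₀ m).eval x := by
  rw [eval_arcsinPoly, eval_arcsinPoly, mul_sum]
  refine sum_congr rfl fun j _ => ?_
  rw [neg_pow, pow_add, pow_mul]
  norm_num
  ring

/-- The coefficient left over when the differential operator is applied to the truncation. -/
noncomputable def arcsinDefect (t : ℝ) (s : ℕ) (u₀ : ℝ) (m : ℕ) : ℝ :=
  ((2 * m + s) ^ 2 - t ^ 2) * arcsinCoeff t s u₀ m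

/-- The coefficient recursion cancels every monomial but the top one. For s ≤ 1 the lowest term
s(s-1)x^(s-2) of the second derivative vanishes. -/
theorem arcsinPoly_ode {t : ℝ} {s : ℕ} (hs : s ≤ 1) (u₀ : ℝ) (m : ℕ) (x : ℝ) :
    (1 - x ^ 2) * (derivative (derivative (arcsinPoly t s u₀ m))).eval x
      - x * (derivative (arcsinPoly t s u₀ m)).eval x + t ^ 2 * (arcsinPoly t s u₀ m).eval x
      = -(arcsinDefect t s u₀ m * x ^ (2 * m + s)) := by
  induction m with
  | zero =>
    rw [arcsinPoly_zero]
    interval_cases s <;> simp [arcsinDefect, arcsinCoeff]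
    ring
  | succ m ih =>
    have hc : arcsinCoeff t s u₀ (m + 1) * ((2 * m + s + 1) * (2 * m + s + 2))
        = arcsinDefect t s u₀ m := by
      rw [arcsinCoeff, arcsinDefect]
      field_simp
    rw [arcsinPoly_succ]
    simp only [derivative_add, derivative_C_mul_X_pow, eval_add, eval_mul, eval_C, eval_pow,
      eval_X, Nat.add_succ_sub_one]
    rw [← hc] at ih
    rw [arcsinDefect, show 2 * (m + 1) + s = 2 * m + s + 2 by ring]
    push_cast
    simp only [add_zero]
    linear_combination ih

theorem arcsinDefect_succ (t : ℝ) (s : ℕ) (u₀ : ℝ) (m : ℕ) :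
    arcsinDefect t s u₀ (m + 1) = arcsinDefect t s u₀ m *
      (((2 * m + s + 2) ^ 2 - t ^ 2) / ((2 * m + s + 1) * (2 * m + s + 2))) := by
  rw [arcsinDefect, arcsinDefect, arcsinCoeff]
  push_cast
  ring

/-- As 2m+s+2 ≥ 2 > t, successive defects never change sign, so the initial one decides. -/
theorem arcsinDefect_ratio_nonneg {t : ℝ} (ht : 0 < t) (ht1 : t ≤ 1) (s m : ℕ) :
    0 ≤ ((2 * m + s + 2 : ℝ) ^ 2 - t ^ 2) / ((2 * m + s + 1) * (2 * m + s + 2)) := by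
  have : (0 : ℝ) ≤ 2 * m + s := by positivity
  exact div_nonneg (by nlinarith) (by positivity)

theorem abs_arcsinDefect_le {t : ℝ} (ht : 0 < t) (ht1 : t ≤ 1) {s : ℕ} {u₀ : ℝ}
    (h0 : |arcsinDefect t s u₀ 0| ≤ 1) (m : ℕ) : |arcsinDefect t s u₀ m| ≤ 2 * m + 1 := by
  induction m with
  | zero => simpa using h0
  | succ m ih =>
    rw [arcsinDefect_succ, abs_mul, abs_of_nonneg (arcsinDefect_ratio_nonneg ht ht1 s m)]
    have hm : (0 : ℝ) ≤ m := by positivity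
    have hs : (0 : ℝ) ≤ s := by positivity
    -- This comparison ratio telescopes to 2m+1.
    have hr : ((2 * m + s + 2 : ℝ) ^ 2 - t ^ 2) / ((2 * m + s + 1) * (2 * m + s + 2))
        ≤ (2 * m + 3) / (2 * m + 1) := by
      rw [div_le_div_iff₀ (by positivity) (by positivity)]
      have : (0 : ℝ) ≤ t ^ 2 * (2 * m + 1) := by positivity
      have : 0 ≤ (2 * m + s + 2 : ℝ) * (s + 1) := by positivity
      nlinarith
    calc _ ≤ (2 * m + 1 : ℝ) * ((2 * m + 3) / (2 * m + 1)) :=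
          mul_le_mul ih hr (arcsinDefect_ratio_nonneg ht ht1 s m) (by positivity)
      _ = _ := by push_cast; field_simp; ring

theorem arcsinDefect_nonneg {t : ℝ} (ht : 0 < t) (ht1 : t ≤ 1) {s : ℕ} {u₀ : ℝ}
    (h0 : 0 ≤ arcsinDefect t s u₀ 0) (m : ℕ) : 0 ≤ arcsinDefect t s u₀ m := by
  induction m with
  | zero => exact h0
  | succ m ih =>
    rw [arcsinDefect_succ]
    exact mul_nonneg ih (arcsinDefect_ratio_nonneg ht ht1 s m)

theorem arcsinDefect_nonpos {t : ℝ} (ht : 0 < t) (ht1 : t ≤ 1) {s : ℕ} {u₀ : ℝ}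
    (h0 : arcsinDefect t s u₀ 0 ≤ 0) (m : ℕ) : arcsinDefect t s u₀ m ≤ 0 := by
  induction m with
  | zero => exact h0
  | succ m ih =>
    rw [arcsinDefect_succ]
    exact mul_nonpos_of_nonpos_of_nonneg ih (arcsinDefect_ratio_nonneg ht ht1 s m)

theorem arcsinCoeff_succ (t : ℝ) (s : ℕ) (u₀ : ℝ) (m : ℕ) :
    arcsinCoeff t s u₀ (m + 1) =
      arcsinDefect t s u₀ m / ((2 * m + s + 1) * (2 * m + s + 2)) := by
  rw [arcsinCoeff, arcsinDefect, mul_comm]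

theorem eval_zero_arcsinPoly (t : ℝ) (s : ℕ) (u₀ : ℝ) (m : ℕ) :
    (arcsinPoly t s u₀ m).eval 0 = u₀ * 0 ^ s := by
  induction m with
  | zero => simp [arcsinPoly_zero]
  | succ m ih => simp [arcsinPoly_succ, ih]

theorem eval_zero_derivative_arcsinPoly (t : ℝ) (s : ℕ) (u₀ : ℝ) (m : ℕ) :
    (derivative (arcsinPoly t s u₀ m)).eval 0 = u₀ * s * 0 ^ (s - 1) := by
  induction m with
  | zero => simp [arcsinPoly_zero, derivative_X_pow, mul_assoc]
  | succ m ih => simp [arcsinPoly_succ, ih]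

theorem hasDerivAt_arcsinPoly_sin (t : ℝ) (s : ℕ) (u₀ : ℝ) (m : ℕ) (θ : ℝ) :
    HasDerivAt (fun θ => (arcsinPoly t s u₀ m).eval (Real.sin θ))
      ((derivative (arcsinPoly t s u₀ m)).eval (Real.sin θ) * Real.cos θ) θ :=
  ((arcsinPoly t s u₀ m).hasDerivAt (Real.sin θ)).comp θ (Real.hasDerivAt_sin θ)

theorem hasDerivAt_derivative_arcsinPoly_sin {t : ℝ} {s : ℕ} (hs : s ≤ 1) (u₀ : ℝ) (m : ℕ)
    (θ : ℝ) :
    HasDerivAt (fun θ => (derivative (arcsinPoly t s u₀ m)).eval (Real.sin θ) * Real.cos θ)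
      (-(arcsinDefect t s u₀ m * Real.sin θ ^ (2 * m + s))
        - t ^ 2 * (arcsinPoly t s u₀ m).eval (Real.sin θ)) θ := by
  have h := (((derivative (arcsinPoly t s u₀ m)).hasDerivAt (Real.sin θ)).comp θ
    (Real.hasDerivAt_sin θ)).mul (Real.hasDerivAt_cos θ)
  refine h.congr_deriv ?_
  have := arcsinPoly_ode (t := t) hs u₀ m (Real.sin θ)
  simp only [Function.comp_apply]
  linear_combination this + (derivative (derivative (arcsinPoly t s u₀ m))).eval (Real.sin θ) *
    Real.cos_sq' θ

/-! ### Truncation error and boundedness -/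

theorem two_mul_add_one_le_two_pow (m : ℕ) : (2 * m + 1 : ℝ) ≤ 2 * 2 ^ m := by
  have := one_add_mul_le_pow (a := (1 : ℝ)) (by norm_num) m
  norm_num at this
  linarith

theorem defect_mul_pow_le {w x : ℝ} {m s : ℕ} (hw : |w| ≤ 2 * m + 1) (hx0 : 0 ≤ x)
    (hx : x ≤ 1 / 2) : |w| * x ^ (2 * m + s) ≤ 2 * (1 / 2) ^ m := by
  have h1 : x ^ (2 * m + s) ≤ (1 / 2) ^ (2 * m) :=
    (pow_le_pow_of_le_one hx0 (by linarith) (Nat.le_add_right _ _)).trans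
      (pow_le_pow_left₀ hx0 hx _)
  calc |w| * x ^ (2 * m + s) ≤ (2 * 2 ^ m) * (1 / 2) ^ (2 * m) :=
        mul_le_mul (hw.trans (two_mul_add_one_le_two_pow m)) h1 (by positivity) (by positivity)
    _ = 2 * (1 / 2) ^ m := by
        rw [two_mul m, pow_add]
        have : (2 : ℝ) ^ m * (1 / 2) ^ m = 1 := by rw [← mul_pow]; norm_num
        linear_combination 2 * (1 / 2 : ℝ) ^ m * this

theorem arcsin_le_pi_div_six {x : ℝ} (hx : x ≤ 1 / 2) : Real.arcsin x ≤ Real.pi / 6 := by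
  have hpi := Real.pi_pos
  rw [Real.arcsin_le_iff_le_sin' ⟨by linarith, by linarith⟩, Real.sin_pi_div_six]
  exact hx

/-- The common estimate: the signed error `e` of a Taylor truncation, composed with `sin`, is
nonnegative on `[0, π/2]` and geometrically small on `[0, π/6]`. -/
theorem truncation_error_bounds {t w : ℝ} {m s : ℕ} {e e₁ : ℝ → ℝ} (ht : 0 < t) (ht1 : t ≤ 1)
    (hw0 : 0 ≤ w) (hw : w ≤ 2 * m + 1) (he0 : e 0 = 0) (he₁0 : e₁ 0 = 0)
    (he : ∀ θ, HasDerivAt e (e₁ θ) θ)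
    (he₁ : ∀ θ, HasDerivAt e₁ (w * Real.sin θ ^ (2 * m + s) - t ^ 2 * e θ) θ)
    {x : ℝ} (hx0 : 0 ≤ x) :
    0 ≤ e (Real.arcsin x) ∧ (x ≤ 1 / 2 → e (Real.arcsin x) ≤ (1 / 2) ^ m) := by
  have hθ := Real.arcsin_nonneg.2 hx0
  have hθ' := Real.arcsin_le_pi_div_two x
  have hpi := Real.pi_pos
  have hsin : ∀ θ ∈ Set.Icc 0 (Real.arcsin x), 0 ≤ Real.sin θ := fun θ h =>
    Real.sin_nonneg_of_nonneg_of_le_pi h.1 (by linarith [h.2])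
  have hnn : ∀ θ ∈ Set.Icc 0 (Real.arcsin x), 0 ≤ w * Real.sin θ ^ (2 * m + s) :=
    fun θ h => mul_nonneg hw0 (pow_nonneg (hsin θ h) _)
  -- Only the sign is kept here, so the crude bound H = w is enough.
  refine ⟨(duhamel_bounds (H := w) ht ht1 hθ hθ' he0 he₁0 he he₁ hnn fun θ h =>
    mul_le_of_le_one_right hw0 (pow_le_one₀ (hsin θ h) (Real.sin_le_one θ))).1, fun hx => ?_⟩
  have h6 := arcsin_le_pi_div_six hx
  have hsin' : ∀ θ ∈ Set.Icc 0 (Real.arcsin x), Real.sin θ ≤ 1 / 2 := fun θ h => by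
    rw [← Real.sin_pi_div_six]
    exact Real.sin_le_sin_of_le_of_le_pi_div_two (by linarith [h.1]) (by linarith)
      (h.2.trans h6)
  have hb := (duhamel_bounds (H := 2 * (1 / 2) ^ m) ht ht1 hθ hθ' he0 he₁0 he he₁ hnn
    fun θ h => by
      have := defect_mul_pow_le (w := w) (s := s) (by rwa [abs_of_nonneg hw0]) (hsin θ h)
        (hsin' θ h)
      rwa [abs_of_nonneg hw0] at this).2
  -- (π/6)² < 1/2 absorbs the factor 2 in H.
  have hsq : Real.arcsin x ^ 2 ≤ 1 / 2 := by nlinarith [Real.pi_lt_d2]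
  have hp : (0 : ℝ) < (1 / 2) ^ m := by positivity
  nlinarith

theorem cos_truncation {t : ℝ} (ht : 0 < t) (ht1 : t ≤ 1) (m : ℕ) {x : ℝ} (hx0 : 0 ≤ x)
    (hx1 : x ≤ 1) :
    |(arcsinPoly t 0 1 m).eval x| ≤ 1 ∧
      (x ≤ 1 / 2 →
        |(arcsinPoly t 0 1 m).eval x - Real.cos (t * Real.arcsin x)| ≤ (1 / 2) ^ m) := by
  have hd0 : arcsinDefect t 0 1 0 = -t ^ 2 := by simp [arcsinDefect, arcsinCoeff]
  have hneg : ∀ j, arcsinDefect t 0 1 j ≤ 0 :=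
    arcsinDefect_nonpos ht ht1 (by rw [hd0]; nlinarith)
  have habs := abs_arcsinDefect_le ht ht1 (s := 0) (u₀ := 1)
    (by rw [hd0, abs_neg, abs_of_nonneg (by positivity)]; nlinarith) m
  rw [abs_of_nonpos (hneg m)] at habs
  have hlin : ∀ θ, HasDerivAt (fun θ : ℝ => t * θ) t θ := fun θ => by
    simpa using (hasDerivAt_id θ).const_mul t
  obtain ⟨h1, h2⟩ := truncation_error_bounds (s := 0)
    (e := fun θ => (arcsinPoly t 0 1 m).eval (Real.sin θ) - Real.cos (t * θ))
    (e₁ := fun θ => (derivative (arcsinPoly t 0 1 m)).eval (Real.sin θ) * Real.cos θ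
      + t * Real.sin (t * θ)) ht ht1 (neg_nonneg.2 (hneg m)) habs
    (by simp [eval_zero_arcsinPoly]) (by simp [eval_zero_derivative_arcsinPoly])
    (fun θ => ((hasDerivAt_arcsinPoly_sin t 0 1 m θ).sub (hlin θ).cos).congr_deriv (by ring))
    (fun θ => ((hasDerivAt_derivative_arcsinPoly_sin (by norm_num) 1 m θ).add
      ((hlin θ).sin.const_mul t)).congr_deriv (by ring)) hx0
  simp only [Real.sin_arcsin (by linarith : -1 ≤ x) hx1] at h1 h2
  have hcos : 0 ≤ Real.cos (t * Real.arcsin x) := by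
    have := Real.arcsin_nonneg.2 hx0
    have := Real.arcsin_le_pi_div_two x
    exact Real.cos_nonneg_of_neg_pi_div_two_le_of_le (by nlinarith [Real.pi_pos]) (by nlinarith)
  -- All coefficients after the constant term 1 are nonpositive, like the defects.
  have hle : (arcsinPoly t 0 1 m).eval x ≤ 1 := by
    rw [eval_arcsinPoly, sum_range_succ']
    have : ∑ j ∈ range m, arcsinCoeff t 0 1 (j + 1) * x ^ (2 * (j + 1) + 0) ≤ 0 := by
      refine sum_nonpos fun j _ => mul_nonpos_of_nonpos_of_nonneg ?_ (by positivity)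
      rw [arcsinCoeff_succ]
      exact div_nonpos_of_nonpos_of_nonneg (hneg j) (by positivity)
    simpa [arcsinCoeff] using this
  refine ⟨abs_le.2 ⟨by linarith, hle⟩, fun hx => ?_⟩
  rw [abs_of_nonneg h1]
  exact h2 hx

theorem sin_truncation {t : ℝ} (ht : 0 < t) (ht1 : t ≤ 1) (m : ℕ) {x : ℝ} (hx0 : 0 ≤ x)
    (hx1 : x ≤ 1) :
    |(arcsinPoly t 1 t m).eval x| ≤ 1 ∧
      (x ≤ 1 / 2 →
        |(arcsinPoly t 1 t m).eval x - Real.sin (t * Real.arcsin x)| ≤ (1 / 2) ^ m) := by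
  have hd0 : arcsinDefect t 1 t 0 = (1 - t ^ 2) * t := by simp [arcsinDefect, arcsinCoeff]
  have hd0' : 0 ≤ arcsinDefect t 1 t 0 := by
    rw [hd0]; exact mul_nonneg (by nlinarith) ht.le
  have hpos : ∀ j, 0 ≤ arcsinDefect t 1 t j := arcsinDefect_nonneg ht ht1 hd0'
  have habs := abs_arcsinDefect_le ht ht1 (s := 1) (u₀ := t)
    (by rw [abs_of_nonneg hd0', hd0]; exact mul_le_one₀ (by nlinarith) ht.le ht1) m
  rw [abs_of_nonneg (hpos m)] at habs
  have hlin : ∀ θ, HasDerivAt (fun θ : ℝ => t * θ) t θ := fun θ => by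
    simpa using (hasDerivAt_id θ).const_mul t
  obtain ⟨h1, h2⟩ := truncation_error_bounds (s := 1)
    (e := fun θ => Real.sin (t * θ) - (arcsinPoly t 1 t m).eval (Real.sin θ))
    (e₁ := fun θ => t * Real.cos (t * θ)
      - (derivative (arcsinPoly t 1 t m)).eval (Real.sin θ) * Real.cos θ) ht ht1 (hpos m) habs
    (by simp [eval_zero_arcsinPoly]) (by simp [eval_zero_derivative_arcsinPoly])
    (fun θ => ((hlin θ).sin.sub (hasDerivAt_arcsinPoly_sin t 1 t m θ)).congr_deriv (by ring))
    (fun θ => (((hlin θ).cos.const_mul t).sub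
      (hasDerivAt_derivative_arcsinPoly_sin le_rfl t m θ)).congr_deriv (by ring)) hx0
  simp only [Real.sin_arcsin (by linarith : -1 ≤ x) hx1] at h1 h2
  have hge : 0 ≤ (arcsinPoly t 1 t m).eval x := by
    rw [eval_arcsinPoly]
    refine sum_nonneg fun j _ => mul_nonneg ?_ (by positivity)
    cases j with
    | zero => exact ht.le
    | succ j =>
      rw [arcsinCoeff_succ]
      exact div_nonneg (hpos j) (by positivity)
  have hs1 := Real.sin_le_one (t * Real.arcsin x)
  refine ⟨abs_le.2 ⟨by linarith, by linarith⟩, fun hx => ?_⟩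
  rw [abs_sub_comm, abs_of_nonneg h1]
  exact h2 hx

/-! ### Symmetry in x and t, and choice of the degree -/

theorem exists_truncations_of_pos {t : ℝ} (ht : 0 < t) (ht1 : t ≤ 1) (m : ℕ) :
    ∃ p q : ℝ[X],
      Function.Even (fun x : ℝ => p.eval x) ∧ Function.Odd (fun x : ℝ => q.eval x) ∧
      p.natDegree ≤ 2 * m + 1 ∧ q.natDegree ≤ 2 * m + 1 ∧
      (∀ x ∈ Set.Icc (-1 : ℝ) 1, |p.eval x| ≤ 1) ∧
      (∀ x ∈ Set.Icc (-1 : ℝ) 1, |q.eval x| ≤ 1) ∧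
      (∀ x ∈ Set.Icc (-(1 / 2) : ℝ) (1 / 2),
        |p.eval x - Real.cos (t * Real.arcsin x)| ≤ (1 / 2) ^ m) ∧
      (∀ x ∈ Set.Icc (-(1 / 2) : ℝ) (1 / 2),
        |q.eval x - Real.sin (t * Real.arcsin x)| ≤ (1 / 2) ^ m) := by
  have hp : ∀ x, (arcsinPoly t 0 1 m).eval (-x) = (arcsinPoly t 0 1 m).eval x := fun x => by
    simp [eval_neg_arcsinPoly]
  have hq : ∀ x, (arcsinPoly t 1 t m).eval (-x) = -(arcsinPoly t 1 t m).eval x := fun x => by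
    simp [eval_neg_arcsinPoly]
  refine ⟨arcsinPoly t 0 1 m, arcsinPoly t 1 t m, hp, hq,
    (natDegree_arcsinPoly_le _ _ _ _).trans (by omega), natDegree_arcsinPoly_le _ _ _ _,
    fun x hx => ?_, fun x hx => ?_, fun x hx => ?_, fun x hx => ?_⟩ <;>
  rcases le_total 0 x with h | h
  · exact (cos_truncation ht ht1 m h hx.2).1
  · rw [← hp]
    exact (cos_truncation ht ht1 m (neg_nonneg.2 h) (by linarith [hx.1])).1
  · exact (sin_truncation ht ht1 m h hx.2).1
  · rw [← abs_neg, ← hq]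
    exact (sin_truncation ht ht1 m (neg_nonneg.2 h) (by linarith [hx.1])).1
  · exact (cos_truncation ht ht1 m h (by linarith [hx.2])).2 hx.2
  · have := (cos_truncation ht ht1 m (neg_nonneg.2 h) (by linarith [hx.1])).2
      (by linarith [hx.1])
    rwa [hp, Real.arcsin_neg, mul_neg, Real.cos_neg] at this
  · exact (sin_truncation ht ht1 m h (by linarith [hx.2])).2 hx.2
  · have := (sin_truncation ht ht1 m (neg_nonneg.2 h) (by linarith [hx.1])).2
      (by linarith [hx.1])
    rwa [hq, Real.arcsin_neg, mul_neg, Real.sin_neg, neg_sub_neg, abs_sub_comm] at this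

theorem exists_truncations {t : ℝ} (ht : -1 ≤ t) (ht1 : t ≤ 1) (m : ℕ) :
    ∃ p q : ℝ[X],
      Function.Even (fun x : ℝ => p.eval x) ∧ Function.Odd (fun x : ℝ => q.eval x) ∧
      p.natDegree ≤ 2 * m + 1 ∧ q.natDegree ≤ 2 * m + 1 ∧
      (∀ x ∈ Set.Icc (-1 : ℝ) 1, |p.eval x| ≤ 1) ∧
      (∀ x ∈ Set.Icc (-1 : ℝ) 1, |q.eval x| ≤ 1) ∧
      (∀ x ∈ Set.Icc (-(1 / 2) : ℝ) (1 / 2),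
        |p.eval x - Real.cos (t * Real.arcsin x)| ≤ (1 / 2) ^ m) ∧
      (∀ x ∈ Set.Icc (-(1 / 2) : ℝ) (1 / 2),
        |q.eval x - Real.sin (t * Real.arcsin x)| ≤ (1 / 2) ^ m) := by
  rcases lt_trichotomy t 0 with h | rfl | h
  · obtain ⟨p, q, hp, hq, hdp, hdq, hbp, hbq, hep, heq⟩ :=
      exists_truncations_of_pos (neg_pos.2 h) (by linarith) m
    refine ⟨p, -q, hp, fun x => ?_, hdp, by rwa [natDegree_neg], hbp, fun x hx => ?_,
      fun x hx => ?_, fun x hx => ?_⟩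
    · have := hq x
      simp only [eval_neg] at this ⊢
      rw [this]
    · simpa using hbq x hx
    · simpa [neg_mul, Real.cos_neg] using hep x hx
    · have := heq x hx
      rw [neg_mul, Real.sin_neg, ← abs_neg] at this
      convert this using 2
      rw [eval_neg]
      ring
  -- At t = 0 the targets are the constants 1 and 0; the Duhamel bound, which divides by t, is not
  -- available.
  · refine ⟨1, 0, fun x => by simp, fun x => by simp, by simp, by simp, by simp, by simp, ?_, ?_⟩
      <;> intro x _ <;> simp
  · exact exists_truncations_of_pos h ht1 m

theorem abs_mul_arcsin_le {t x : ℝ} (ht : -1 ≤ t) (ht1 : t ≤ 1)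
    (hx : x ∈ Set.Icc (-(1 / 2) : ℝ) (1 / 2)) : |t * Real.arcsin x| ≤ Real.pi / 6 := by
  have h1 : |Real.arcsin x| ≤ Real.pi / 6 := by
    have h := arcsin_le_pi_div_six (x := -x) (by linarith [hx.1])
    rw [Real.arcsin_neg] at h
    exact abs_le.2 ⟨by linarith, arcsin_le_pi_div_six hx.2⟩
  rw [abs_mul]
  exact (mul_le_of_le_one_left (abs_nonneg _) (abs_le.2 ⟨ht, ht1⟩)).trans h1

theorem corollary3p7 :
    ∃ C : ℝ, 0 < C ∧ ∀ ε : ℝ, 0 < ε → ε < 1 → ∀ t : ℝ, -1 ≤ t → t ≤ 1 →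
      ∃ p q : Polynomial ℝ,
        Function.Even (fun x : ℝ => p.eval x) ∧
        Function.Odd (fun x : ℝ => q.eval x) ∧
        (p.natDegree : ℝ) ≤ C * Real.log (1 / ε) ∧
        (q.natDegree : ℝ) ≤ C * Real.log (1 / ε) ∧
        (∀ x ∈ Set.Icc (-1 : ℝ) 1, |p.eval x| ≤ 1) ∧
        (∀ x ∈ Set.Icc (-1 : ℝ) 1, |q.eval x| ≤ 1) ∧
        (∀ x ∈ Set.Icc (-(1 / 2) : ℝ) (1 / 2),
          |p.eval x - Real.cos (t * Real.arcsin x)| ≤ ε) ∧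
        (∀ x ∈ Set.Icc (-(1 / 2) : ℝ) (1 / 2),
          |q.eval x - Real.sin (t * Real.arcsin x)| ≤ ε) := by
  have hl2 : 0 < Real.log 2 := Real.log_pos (by norm_num)
  refine ⟨5 / Real.log 2, by positivity, fun ε hε hε1 t ht ht1 => ?_⟩
  have hlog : 0 < Real.log (1 / ε) := Real.log_pos (by rw [lt_div_iff₀ hε]; linarith)
  -- As ε → 1 the degree budget tends to 0, so constants must serve: with |y| ≤ π/6, both 1 - cos y
  -- ≤ y²/2 and |sin y| are at most 1/2.
  rcases le_or_gt (1 / 2) ε with h | h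
  · refine ⟨1, 0, fun x => by simp, fun x => by simp, ?_, ?_, by simp, by simp, ?_, ?_⟩
    · simp only [natDegree_one, Nat.cast_zero]; positivity
    · simp only [natDegree_zero, Nat.cast_zero]; positivity
    · intro x hx
      have hy := abs_mul_arcsin_le ht ht1 hx
      have h1 := Real.one_sub_sq_div_two_le_cos (x := t * Real.arcsin x)
      have h2 := Real.cos_le_one (t * Real.arcsin x)
      rw [eval_one, abs_of_nonneg (by linarith)]
      have : (t * Real.arcsin x) ^ 2 ≤ 1 := by
        rw [sq_le_one_iff_abs_le_one]
        linarith [Real.pi_lt_d2]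
      linarith
    · intro x hx
      obtain ⟨hy1, hy2⟩ := abs_le.1 (abs_mul_arcsin_le ht ht1 hx)
      have hpi := Real.pi_pos
      have h1 := Real.sin_le_sin_of_le_of_le_pi_div_two (by linarith) (by linarith) hy2
      have h2 := Real.sin_le_sin_of_le_of_le_pi_div_two (by linarith) (by linarith) hy1
      rw [Real.sin_neg] at h2
      rw [Real.sin_pi_div_six] at h1 h2
      rw [eval_zero, zero_sub, abs_neg]
      exact (abs_le.2 ⟨h2, h1⟩).trans h
  · set L := Real.log (1 / ε) / Real.log 2 with hL
    have hL1 : 1 ≤ L := by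
      rw [hL, le_div_iff₀ hl2, one_mul]
      exact Real.log_le_log (by norm_num) (by rw [le_div_iff₀ hε]; linarith)
    have hm1 : L ≤ ⌈L⌉₊ := Nat.le_ceil L
    have hm2 := Nat.ceil_lt_add_one (show 0 ≤ L by linarith)
    have hpow : (1 / 2 : ℝ) ^ ⌈L⌉₊ ≤ ε := by
      rw [hL, div_le_iff₀ hl2, ← hL, ← Real.log_pow,
        Real.log_le_log_iff (by positivity) (by positivity), div_le_iff₀ hε] at hm1
      rw [div_pow, one_pow, div_le_iff₀ (by positivity)]
      linarith
    -- The constant 5: 2⌈L⌉ + 1 < 2L + 3 ≤ 5L, since ε < 1/2 gives L ≥ 1.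
    have hdeg : ∀ d : ℕ, d ≤ 2 * ⌈L⌉₊ + 1 → (d : ℝ) ≤ 5 / Real.log 2 * Real.log (1 / ε) :=
      fun d hd => by
        have hd' : (d : ℝ) ≤ 2 * ⌈L⌉₊ + 1 := by exact_mod_cast hd
        calc (d : ℝ) ≤ 5 * L := by linarith
          _ = _ := by rw [hL]; ring
    obtain ⟨p, q, hp, hq, hdp, hdq, hbp, hbq, hep, heq⟩ := exists_truncations ht ht1 ⌈L⌉₊
    exact ⟨p, q, hp, hq, hdeg _ hdp, hdeg _ hdq, hbp, hbq, fun x hx => (hep x hx).trans hpow,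
      fun x hx => (heq x hx).trans hpow⟩
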